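/- Let $L$ be a frame with Heyting implication $\to$. An $L$-ordered set is a set $P$ with a map $e:P\times P\to L$ such that $e(x,x)=1$, $e(x,y)\wedge e(y,z)\le e(x,z)$, and $e(x,y)\wedge e(y,x)=1$ implies $x=y$. For $A,B\in L^X$ put $\mathrm{sub}_X(A,B)=\bigwedge_{x\in X}A(x)\to B(x)$. An element $s\in P$ is the supremum $\sqcup A$ of $A\in L^P$ if $e(s,y)=\mathrm{sub}_P(A,e(-,y))$ for all $y\in P$. An $L$-subset $D\in L^P$ is directed if $\bigvee_{x}D(x)=1$ and $D(x)\wedge D(y)\le\bigvee_{z}D(z)\wedge e(x,z)\wedge e(y,z)$ for all $x,y\in P$; $P$ is an $L$-dcpo if every directed $L$-subset has a supremum. For $x\in P$ let $$\Downarrow\! x\,(y)=\bigwedge_{D} \Big(e(x,\sqcup D)\to\bigvee_{d\in P}D(d)\wedge e(y,d)\Big),$$ where $D$ ranges over the directed $L$-subsets of $P$ that have a supremum. $P$ is continuous if for every $x\in P$ the $L$-subset $\Downarrow\! x$ is directed with supremum $x$. A map $f:P\to Q$ of $L$-ordered sets is Scott continuous if for every directed $D\in L^P$ that has a supremum, the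 $L$-subset $f^{\to}(D)(y)=\bigvee_{f(x)=y}D(x)$ of $Q$ has supremum $f(\sqcup D)$. The Scott $L$-topology $\sigma_L(P)$ consists of all $A\in L^P$ such that $A(x)\wedge e(x,y)\le A(y)$ for all $x,y\in P$ and $A(\sqcup D)=\bigvee_{x}A(x)\wedge D(x)$ for every directed $D$ that has a supremum. A point of $\sigma_L(P)$ is a map $p:\sigma_L(P)\to L$ that preserves binary meets and arbitrary joins and satisfies $p(a_P)=a$ for every constant $L$-subset $a_P$, $a\in L$. The set $\mathrm{pt}_L\sigma_L(P)$ of all points carries the inclusion $L$-order $\mathrm{sub}_{\sigma_L(P)}(p,q)=\bigwedge_{A\in\sigma_L(P)}p(A)\to q(A)$, and $\eta_P:P\to\mathrm{pt}_L\sigma_L(P)$ is defined by $\eta_P(x)(A)=A(x)$. **Theorem.** Let $P$ be a continuous $L$-ordered set. Then $(\mathrm{pt}_L\sigma_L(P),\mathrm{sub}_{\sigma_L(P)})$ with $\eta_P$ is a directed completion of $P$. That is, $\mathrm{pt}_L\sigma_L(P)$ is a continuous $L$-dcpo, $\eta_P$ is Scott continuous, and for every continuous $L$-dcpo $M$ and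 every Scott continuous map $f:P\to M$ there is a unique Scott continuous map $\overline f:\mathrm{pt}_L\sigma_L(P)\to M$ with $\overline f\circ\eta_P=f$. Consequently, the category $L$-$\mathbf{CDom}$ of continuous $L$-dcpo's and Scott continuous maps is a reflective full subcategory of the category $L$-$\mathbf{CPos}$ of continuous $L$-ordered sets and Scott continuous maps. -/

import Mathlib

open CategoryTheory

universe u v w

/-- The inclusion degree `sub(A, B) = ⋀ₓ A(x) → B(x)` of two `L`-subsets of `X`. -/
def LSub {L : Type u} [Order.Frame L] {X : Type v} (A B : X → L) : L :=
  ⨅ x, A x ⇨ B x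

/-- The (forward) Zadeh extension: `f^→(A)(y) = ⋁_{f(x) = y} A(x)`. -/
def LImage {L : Type u} [Order.Frame L] {X : Type v} {Y : Type w} (f : X → Y) (A : X → L) :
    Y → L :=
  fun y => ⨆ (x : X) (_ : f x = y), A x

/-- An `L`-order on a set `P`. -/
structure LOrder (L : Type u) [Order.Frame L] (P : Type v) where
  /-- the degree to which `x` is below `y` -/
  e : P → P → L
  refl : ∀ x, e x x = ⊤
  trans : ∀ x y z, e x y ⊓ e y z ≤ e x z
  antisymm : ∀ x y, e x y ⊓ e y x = ⊤ → x = y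

namespace LOrder

variable {L : Type u} [Order.Frame L] {P : Type v} {Q : Type w}

/-- The principal lower set `↓y`, `(↓y)(x) = e(x, y)`. -/
def down (E : LOrder L P) (y : P) : P → L := fun x => E.e x y

/-- Upper sets: `A(x) ∧ e(x, y) ≤ A(y)`. -/
def IsUpper (E : LOrder L P) (A : P → L) : Prop :=
  ∀ x y, A x ⊓ E.e x y ≤ A y

/-- `x` is a supremum of the `L`-subset `A`: `e(x, y) = sub(A, ↓y)` for all `y`. -/
def IsSup (E : LOrder L P) (A : P → L) (x : P) : Prop :=
  ∀ y, E.e x y = LSub A (E.down y)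

/-- Directed `L`-subsets (nonemptiness, i.e. `⋁ₓ D(x) = 1`, included). -/
def IsDirected (E : LOrder L P) (D : P → L) : Prop :=
  (⨆ x, D x) = ⊤ ∧ ∀ x y, D x ⊓ D y ≤ ⨆ z, D z ⊓ E.e x z ⊓ E.e y z

/-- `P` is an `L`-dcpo: every directed `L`-subset has a supremum. -/
def IsDcpo (E : LOrder L P) : Prop :=
  ∀ D : P → L, E.IsDirected D → ∃ x, E.IsSup D x

/-- `wayBelow x y` is the degree to which `y` is way below `x`: the infimum, over all directed
`L`-subsets `D` that have a supremum `s`, of `e(x, s) → ⋁_d D(d) ∧ e(y, d)`. -/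
def wayBelow (E : LOrder L P) (x : P) : P → L := fun y =>
  ⨅ (D : P → L) (s : P) (_ : E.IsDirected D) (_ : E.IsSup D s),
    E.e x s ⇨ ⨆ d, D d ⊓ E.e y d

/-- Continuous `L`-ordered sets: for every `x`, the `L`-subset of elements way below `x` is
directed and has supremum `x`. -/
def IsContinuous (E : LOrder L P) : Prop :=
  ∀ x, E.IsDirected (E.wayBelow x) ∧ E.IsSup (E.wayBelow x) x

/-- Scott continuous maps: for every directed `D` with supremum `s`, the supremum of `f^→(D)`
exists and is `f s`. -/
def ScottContinuous (E : LOrder L P) (F : LOrder L Q) (f : P → Q) : Prop :=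
  ∀ (D : P → L) (s : P), E.IsDirected D → E.IsSup D s → F.IsSup (LImage f D) (f s)

/-- Scott open sets: upper sets `A` with `A(⊔D) = ⋁ₓ A(x) ∧ D(x)` for every directed `D` that has
a supremum. -/
def IsScottOpen (E : LOrder L P) (A : P → L) : Prop :=
  E.IsUpper A ∧
    ∀ (D : P → L) (s : P), E.IsDirected D → E.IsSup D s → A s = ⨆ x, A x ⊓ D x

end LOrder

/-- A (stratified) `L`-topology on `X`. -/
structure LTopology (L : Type u) [Order.Frame L] (X : Type v) where
  opens : Set (X → L)
  inf_mem : ∀ A ∈ opens, ∀ B ∈ opens, A ⊓ B ∈ opens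
  sSup_mem : ∀ S : Set (X → L), S ⊆ opens → sSup S ∈ opens
  const_mem : ∀ a : L, (fun _ => a) ∈ opens

namespace LTopology

variable {L : Type u} [Order.Frame L] {X : Type v}

/-- The type of open sets of an `L`-topology. -/
abbrev Open (T : LTopology L X) : Type (max u v) := {A : X → L // A ∈ T.opens}

/-- Binary meet of open sets. -/
def Open.inf {T : LTopology L X} (A B : T.Open) : T.Open :=
  ⟨A.1 ⊓ B.1, T.inf_mem A.1 A.2 B.1 B.2⟩

/-- Join of a family of open sets. -/
def Open.sup {T : LTopology L X} (S : Set T.Open) : T.Open :=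
  ⟨sSup (Subtype.val '' S), T.sSup_mem _ (by rintro _ ⟨A, -, rfl⟩; exact A.2)⟩

/-- The constant open sets. -/
def Open.const (T : LTopology L X) (a : L) : T.Open := ⟨fun _ => a, T.const_mem a⟩

/-- A point of `𝒪(X)`: a map `𝒪(X) → L` that preserves binary meets, arbitrary joins and the
constants (an `L`-frame homomorphism from `𝒪(X)` to `L`). -/
structure IsPoint (T : LTopology L X) (p : T.Open → L) : Prop where
  map_inf : ∀ A B : T.Open, p (A.inf B) = p A ⊓ p B
  map_sup : ∀ S : Set T.Open, p (Open.sup S) = ⨆ A ∈ S, p A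
  map_const : ∀ a : L, p (Open.const T a) = a

/-- The set `pt_L 𝒪(X)` of points. -/
abbrev Pt (T : LTopology L X) : Type (max u v) := {p : T.Open → L // T.IsPoint p}

/-- The inclusion `L`-order on `pt_L 𝒪(X)`. -/
def ptOrder (T : LTopology L X) : LOrder L T.Pt where
  e p q := LSub p.1 q.1
  refl p := by simp [LSub]
  trans p q r := by
    refine le_iInf fun A => ?_
    refine (inf_le_inf (iInf_le _ A) (iInf_le _ A)).trans ?_
    exact himp_triangle _ _ _
  antisymm p q h := by
    have h' := inf_eq_top_iff.1 h
    refine Subtype.ext (funext fun A => le_antisymm ?_ ?_)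
    · exact himp_eq_top_iff.1 (iInf_eq_top.1 h'.1 A)
    · exact himp_eq_top_iff.1 (iInf_eq_top.1 h'.2 A)

/-- The map `η_X : X → pt_L 𝒪(X)`, `x ↦ [x]`, where `[x](A) = A(x)`. -/
def eta (T : LTopology L X) (x : X) : T.Pt :=
  ⟨fun A => A.1 x,
    { map_inf := fun _ _ => rfl
      map_sup := fun S => by
        change (sSup (Subtype.val '' S) : X → L) x = _
        rw [sSup_image]
        simp only [iSup_apply]
      map_const := fun _ => rfl }⟩

end LTopology

namespace LOrder

variable {L : Type u} [Order.Frame L] {P : Type v} {Q : Type w}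

/-- The Scott `L`-topology `σ_L(P)`. -/
def scott (E : LOrder L P) : LTopology L P where
  opens := {A | E.IsScottOpen A}
  inf_mem := by
    rintro A ⟨hA, hA'⟩ B ⟨hB, hB'⟩
    refine ⟨fun x y => le_inf ?_ ?_, fun D s hD hs => le_antisymm ?_ ?_⟩
    · exact (inf_le_inf_right _ inf_le_left).trans (hA x y)
    · exact (inf_le_inf_right _ inf_le_right).trans (hB x y)
    · simp only [Pi.inf_apply]
      rw [hA' D s hD hs, hB' D s hD hs, iSup_inf_iSup]
      refine iSup_le fun ⟨x, y⟩ => ?_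
      calc A x ⊓ D x ⊓ (B y ⊓ D y) = A x ⊓ B y ⊓ (D x ⊓ D y) := by ac_rfl
        _ ≤ A x ⊓ B y ⊓ ⨆ z, D z ⊓ E.e x z ⊓ E.e y z := inf_le_inf_left _ (hD.2 x y)
        _ ≤ _ := by
          rw [inf_iSup_eq]
          refine iSup_mono fun z => ?_
          calc A x ⊓ B y ⊓ (D z ⊓ E.e x z ⊓ E.e y z)
              = (A x ⊓ E.e x z) ⊓ (B y ⊓ E.e y z) ⊓ D z := by ac_rfl
            _ ≤ _ := inf_le_inf_right _ (inf_le_inf (hA x z) (hB y z))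
    · rw [Pi.inf_apply, hA' D s hD hs, hB' D s hD hs]
      exact iSup_le fun x => le_inf
        ((inf_le_inf_right _ inf_le_left).trans (le_iSup (fun x => A x ⊓ D x) x))
        ((inf_le_inf_right _ inf_le_right).trans (le_iSup (fun x => B x ⊓ D x) x))
  sSup_mem := by
    intro S hS
    refine ⟨fun x y => ?_, fun D s hD hs => ?_⟩
    · simp only [sSup_apply, iSup_inf_eq]
      exact iSup_mono fun A => (hS A.2).1 x y
    · simp only [sSup_apply, iSup_inf_eq]
      rw [iSup_comm]
      exact iSup_congr fun A => (hS A.2).2 D s hD hs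
  const_mem := by
    intro a
    refine ⟨fun x y => inf_le_left, fun D s hD hs => ?_⟩
    rw [← inf_iSup_eq, hD.1, inf_top_eq]

/-- `(Q, j)` is a directed completion of the continuous `L`-ordered set `P`: `Q` is a continuous
`L`-dcpo, `j` is Scott continuous, and every Scott continuous map from `P` to a continuous
`L`-dcpo `M` (in the universe `w'`) factors uniquely through `j` by a Scott continuous map. -/
def IsDirectedCompletion.{w', u', v', v''} {L : Type u'} [Order.Frame L] {P : Type v'}
    {Q : Type v''} (E : LOrder L P) (F : LOrder L Q) (j : P → Q) : Prop :=
  F.IsContinuous ∧ F.IsDcpo ∧ E.ScottContinuous F j ∧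
    ∀ (M : Type w') (G : LOrder L M), G.IsContinuous → G.IsDcpo →
      ∀ f : P → M, E.ScottContinuous G f →
        ∃! g : Q → M, F.ScottContinuous G g ∧ g ∘ j = f

/-! Scott continuous maps form a category. -/

theorem IsSup.le {E : LOrder L P} {D : P → L} {s : P} (h : E.IsSup D s) (x : P) :
    D x ≤ E.e x s := by
  have h1 : (⊤ : L) = LSub D (E.down s) := by rw [← h s, E.refl]
  exact himp_eq_top_iff.1 (iInf_eq_top.1 h1.symm x)

theorem isDirected_down (E : LOrder L P) (y : P) : E.IsDirected (E.down y) :=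
  ⟨top_le_iff.1 (by rw [← E.refl y]; exact le_iSup (E.down y) y),
    fun x z => le_iSup_of_le y (by simp [down, E.refl])⟩

theorem isSup_down (E : LOrder L P) (y : P) : E.IsSup (E.down y) y := by
  intro z
  refine le_antisymm (le_iInf fun x => ?_) ?_
  · rw [le_himp_iff, inf_comm]
    exact E.trans x y z
  · refine (iInf_le _ y).trans ?_
    simp [down, E.refl]

theorem ScottContinuous.mono {E : LOrder L P} {F : LOrder L Q} {f : P → Q}
    (hf : E.ScottContinuous F f) (x y : P) : E.e x y ≤ F.e (f x) (f y) :=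
  (le_iSup₂_of_le (f := fun (a : P) (_ : f a = f x) => E.e a y) x rfl le_rfl).trans
    ((hf _ _ (E.isDirected_down y) (E.isSup_down y)).le (f x))

theorem ScottContinuous.isDirected_image {E : LOrder L P} {F : LOrder L Q} {f : P → Q}
    (hf : E.ScottContinuous F f) {D : P → L} (hD : E.IsDirected D) :
    F.IsDirected (LImage f D) := by
  have key (x : P) : D x ≤ LImage f D (f x) :=
    le_iSup₂_of_le (f := fun (a : P) (_ : f a = f x) => D a) x rfl le_rfl
  refine ⟨top_le_iff.1 ?_, fun a b => ?_⟩
  · rw [← hD.1]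
    exact iSup_le fun x => le_iSup_of_le (f x) (key x)
  · simp only [LImage, iSup_inf_eq, inf_iSup_eq]
    refine iSup₂_le fun x hx => iSup₂_le fun y hy => ?_
    subst hx hy
    refine le_trans (le_of_eq ?_) ((hD.2 x y).trans (iSup_le fun z => ?_))
    · ac_rfl
    · refine le_iSup_of_le (f z) (le_iSup₂_of_le z rfl ?_)
      exact le_trans (le_of_eq (by ac_rfl))
        (inf_le_inf (inf_le_inf_left _ (hf.mono y z)) (hf.mono x z))

theorem scottContinuous_id (E : LOrder L P) : E.ScottContinuous E id := by
  intro D s _ hs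
  have : LImage id D = D := by
    funext y
    simp [LImage]
  rw [this]
  exact hs

theorem ScottContinuous.comp.{v₃} {R : Type v₃} {E : LOrder L P} {F : LOrder L Q} {G : LOrder L R}
    {g : Q → R} {f : P → Q} (hg : F.ScottContinuous G g) (hf : E.ScottContinuous F f) :
    E.ScottContinuous G (g ∘ f) := by
  intro D s hD hs
  have : LImage (g ∘ f) D = LImage g (LImage f D) := by
    funext y
    refine le_antisymm (iSup₂_le fun x hx => ?_) (iSup₂_le fun z hz => iSup₂_le fun x hx => ?_)
    · exact le_iSup₂_of_le (f x) hx (le_iSup₂_of_le x rfl le_rfl)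
    · exact le_iSup₂_of_le x (by simp [hx, hz]) le_rfl
  rw [this]
  exact hg _ _ (hf.isDirected_image hD) (hf D s hD hs)

end LOrder

/-- Objects of `L`-**CPos**: continuous `L`-ordered sets. -/
structure LCPos (L : Type u) [Order.Frame L] : Type (max u (w + 1)) where
  carrier : Type w
  order : LOrder L carrier
  continuous : order.IsContinuous

namespace LCPos

variable {L : Type u} [Order.Frame L]

/-- Morphisms of `L`-**CPos**: Scott continuous maps. -/
@[ext]
structure Hom (P Q : LCPos.{u, w} L) : Type w where
  toFun : P.carrier → Q.carrier
  scottContinuous : P.order.ScottContinuous Q.order toFun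

instance : Category.{w} (LCPos.{u, w} L) where
  Hom := Hom
  id P := ⟨id, P.order.scottContinuous_id⟩
  comp f g := ⟨g.toFun ∘ f.toFun, g.scottContinuous.comp f.scottContinuous⟩

/-- The property of being an `L`-dcpo. -/
def isDcpo (L : Type u) [Order.Frame L] : ObjectProperty (LCPos.{u, w} L) :=
  fun P => P.order.IsDcpo

end LCPos

/-- The category `L`-**CDom** of continuous `L`-dcpo's and Scott continuous maps. -/
abbrev LCDom (L : Type u) [Order.Frame L] : Type (max u (w + 1)) :=
  (LCPos.isDcpo.{u, w} L).FullSubcategory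

/-- The inclusion functor from `L`-**CDom** to `L`-**CPos**. -/
abbrev LCDom.inclusion (L : Type u) [Order.Frame L] : LCDom.{u, w} L ⥤ LCPos.{u, w} L :=
  (LCPos.isDcpo.{u, w} L).ι

namespace LOrder

variable {L : Type u} [Order.Frame L] {P : Type v} {Q : Type w}

/-! Since each `x` is the supremum of the directed `⇓x`, a Scott open `A` satisfies `A = ⋁_y A(y) ∧
⇑y`, where `⇑y` is the map `x ↦ ⇓x(y)`, open by interpolation. A point preserves joins, binary meets
and constants, so it is determined by its rounded ideal `I_p(y) = p(⇑y)` (`IsContinuous.pt_apply`);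
`I_p` is directed, `I_{η x} = ⇓x`, and the order of points is inclusion of ideals.

Directed joins of points are computed pointwise (`directedJoin`), which makes the points an `L`-dcpo
and `η` Scott continuous. Moreover `p` is the directed supremum of `η^→(I_p)`, and `⇓p` is the lower
closure of that `L`-subset (`IsContinuous.wayBelow_pt`), whence continuity. A Scott continuous
extension of `f` must therefore send `p` to `⊔ f^→(I_p)`, and this formula works because `p ↦ I_p`
preserves directed suprema. -/

theorem LSub_inf_le {X : Type v} (A B : X → L) (x : X) : A x ⊓ LSub A B ≤ B x :=
  (inf_le_inf_left _ (iInf_le _ x)).trans inf_himp_le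

theorem le_LSub_iff {X : Type v} {a : L} {A B : X → L} : a ≤ LSub A B ↔ ∀ x, a ⊓ A x ≤ B x := by
  simp [LSub]

theorem LSub_LImage {X : Type v} {Y : Type w} (f : X → Y) (A : X → L) (B : Y → L) :
    LSub (LImage f A) B = LSub A (B ∘ f) := by
  simp only [LSub, LImage, iSup_himp_eq, Function.comp]
  rw [iInf_comm]
  exact iInf_congr fun x => by simp

/-- Suprema of an `L`-subset are unique. -/
theorem IsSup.unique {E : LOrder L P} {D : P → L} {s t : P} (hs : E.IsSup D s)
    (ht : E.IsSup D t) : s = t := by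
  refine E.antisymm s t ?_
  rw [hs t, ← ht t, ht s, ← hs s, E.refl, E.refl, inf_top_eq]

/-- Lets a supremum of an image be tested on the source, without the fibrewise join. -/
theorem isSup_LImage_iff {F : LOrder L Q} {f : P → Q} {D : P → L} {s : Q} :
    F.IsSup (LImage f D) s ↔ ∀ y, F.e s y = ⨅ x, D x ⇨ F.e (f x) y :=
  forall_congr' fun y => by rw [LSub_LImage]; rfl

/-- The lower closure of an `L`-subset. -/
def lowerClosure (E : LOrder L P) (D : P → L) : P → L := fun y => ⨆ d, D d ⊓ E.e y d

theorem IsDirected.lowerClosure {E : LOrder L P} {D : P → L} (hD : E.IsDirected D) :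
    E.IsDirected (E.lowerClosure D) := by
  have key (x : P) : D x ≤ E.lowerClosure D x := le_iSup_of_le x (by simp [E.refl])
  refine ⟨top_le_iff.1 (hD.1.ge.trans (iSup_mono key)), fun x y => ?_⟩
  simp only [LOrder.lowerClosure, iSup_inf_iSup]
  refine iSup_le fun ⟨a, b⟩ => ?_
  calc D a ⊓ E.e x a ⊓ (D b ⊓ E.e y b) = D a ⊓ D b ⊓ (E.e x a ⊓ E.e y b) := by ac_rfl
    _ ≤ (⨆ z, D z ⊓ E.e a z ⊓ E.e b z) ⊓ (E.e x a ⊓ E.e y b) := inf_le_inf_right _ (hD.2 a b)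
    _ ≤ _ := by
      rw [iSup_inf_eq]
      refine iSup_mono fun z => ?_
      calc D z ⊓ E.e a z ⊓ E.e b z ⊓ (E.e x a ⊓ E.e y b)
          = D z ⊓ (E.e x a ⊓ E.e a z) ⊓ (E.e y b ⊓ E.e b z) := by ac_rfl
        _ ≤ _ := inf_le_inf (inf_le_inf (key z) (E.trans _ _ _)) (E.trans _ _ _)

theorem IsSup.lowerClosure {E : LOrder L P} {D : P → L} {s : P} (hs : E.IsSup D s) :
    E.IsSup (E.lowerClosure D) s := by
  intro y
  refine le_antisymm (le_LSub_iff.2 fun x => ?_) ?_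
  · rw [LOrder.lowerClosure, inf_iSup_eq]
    refine iSup_le fun d => ?_
    calc E.e s y ⊓ (D d ⊓ E.e x d) ≤ E.e s y ⊓ (E.e d s ⊓ E.e x d) :=
          inf_le_inf_left _ (inf_le_inf_right _ (hs.le d))
      _ = (E.e x d ⊓ E.e d s) ⊓ E.e s y := by ac_rfl
      _ ≤ E.e x y := (inf_le_inf_right _ (E.trans _ _ _)).trans (E.trans _ _ _)
  · rw [hs y]
    exact iInf_mono fun x => himp_le_himp_right (le_iSup_of_le x (by simp [E.refl]))

/-! ### The way-below relation -/

theorem wayBelow_inf_le (E : LOrder L P) {D : P → L} {s : P} (hD : E.IsDirected D)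
    (hs : E.IsSup D s) (x y : P) : E.wayBelow x y ⊓ E.e x s ≤ E.lowerClosure D y := by
  rw [← le_himp_iff]
  exact iInf₂_le_of_le D s (iInf₂_le hD hs)

theorem wayBelow_le (E : LOrder L P) {D : P → L} {s : P} (hD : E.IsDirected D)
    (hs : E.IsSup D s) (y : P) : E.wayBelow s y ≤ E.lowerClosure D y := by
  simpa [E.refl] using E.wayBelow_inf_le hD hs s y

theorem le_wayBelow (E : LOrder L P) {a : L} {x y : P}
    (h : ∀ D s, E.IsDirected D → E.IsSup D s → a ⊓ E.e x s ≤ E.lowerClosure D y) :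
    a ≤ E.wayBelow x y :=
  le_iInf₂ fun D s => le_iInf₂ fun hD hs => le_himp_iff.2 (h D s hD hs)

theorem wayBelow_le_e (E : LOrder L P) (x y : P) : E.wayBelow x y ≤ E.e y x := by
  refine (E.wayBelow_le (E.isDirected_down x) (E.isSup_down x) y).trans (iSup_le fun d => ?_)
  rw [inf_comm]
  exact E.trans _ _ _

theorem wayBelow_inf_e_le (E : LOrder L P) (x x' y : P) :
    E.wayBelow x y ⊓ E.e x x' ≤ E.wayBelow x' y := by
  refine E.le_wayBelow fun D s hD hs => ?_
  rw [inf_assoc]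
  exact (inf_le_inf_left _ (E.trans _ _ _)).trans (E.wayBelow_inf_le hD hs x y)

theorem e_inf_wayBelow_le (E : LOrder L P) (x y y' : P) :
    E.e y' y ⊓ E.wayBelow x y ≤ E.wayBelow x y' := by
  refine E.le_wayBelow fun D s hD hs => ?_
  rw [inf_assoc]
  refine (inf_le_inf_left _ (E.wayBelow_inf_le hD hs x y)).trans ?_
  rw [lowerClosure, inf_iSup_eq]
  refine iSup_mono fun d => ?_
  rw [inf_left_comm]
  exact inf_le_inf_left _ (E.trans _ _ _)

/-! ### Interpolation and rounded ideals -/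

section Continuous

variable {E : LOrder L P} (hE : E.IsContinuous)

include hE

/-- The way-below relation of a continuous `L`-ordered set is interpolative. -/
theorem IsContinuous.wayBelow_le_iSup (x y : P) :
    E.wayBelow x y ≤ ⨆ z, E.wayBelow z y ⊓ E.wayBelow x z := by
  -- The join of the `⇓z` weighted by `⇓x(z)`. It is directed with supremum `x`, so it may serve as
  -- a test set for `⇓x`.
  let D : P → L := fun y => ⨆ z, E.wayBelow z y ⊓ E.wayBelow x z
  have hD : E.IsDirected D := by
    refine ⟨?_, fun y₁ y₂ => ?_⟩
    · simp only [D]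
      rw [iSup_comm]
      simp only [← iSup_inf_eq, (hE _).1.1, top_inf_eq]
    · simp only [D]
      rw [iSup_inf_iSup]
      refine iSup_le fun ⟨z₁, z₂⟩ => ?_
      calc E.wayBelow z₁ y₁ ⊓ E.wayBelow x z₁ ⊓ (E.wayBelow z₂ y₂ ⊓ E.wayBelow x z₂)
          = E.wayBelow z₁ y₁ ⊓ E.wayBelow z₂ y₂ ⊓ (E.wayBelow x z₁ ⊓ E.wayBelow x z₂) := by
            ac_rfl
        _ ≤ E.wayBelow z₁ y₁ ⊓ E.wayBelow z₂ y₂ ⊓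
            ⨆ z, E.wayBelow x z ⊓ E.e z₁ z ⊓ E.e z₂ z := inf_le_inf_left _ ((hE x).1.2 _ _)
        _ ≤ _ := by
          rw [inf_iSup_eq]
          refine iSup_le fun z => ?_
          calc E.wayBelow z₁ y₁ ⊓ E.wayBelow z₂ y₂ ⊓ (E.wayBelow x z ⊓ E.e z₁ z ⊓ E.e z₂ z)
              = (E.wayBelow z₁ y₁ ⊓ E.e z₁ z) ⊓ (E.wayBelow z₂ y₂ ⊓ E.e z₂ z) ⊓
                  E.wayBelow x z := by ac_rfl
            _ ≤ E.wayBelow z y₁ ⊓ E.wayBelow z y₂ ⊓ E.wayBelow x z :=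
              inf_le_inf_right _
                (inf_le_inf (E.wayBelow_inf_e_le _ _ _) (E.wayBelow_inf_e_le _ _ _))
            _ ≤ (⨆ t, E.wayBelow z t ⊓ E.e y₁ t ⊓ E.e y₂ t) ⊓ E.wayBelow x z :=
              inf_le_inf_right _ ((hE z).1.2 _ _)
            _ ≤ _ := by
              rw [iSup_inf_eq]
              refine iSup_mono fun t => ?_
              calc E.wayBelow z t ⊓ E.e y₁ t ⊓ E.e y₂ t ⊓ E.wayBelow x z
                  = E.wayBelow z t ⊓ E.wayBelow x z ⊓ E.e y₁ t ⊓ E.e y₂ t := by ac_rfl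
                _ ≤ _ := inf_le_inf_right _ (inf_le_inf_right _
                  (le_iSup (fun z => E.wayBelow z t ⊓ E.wayBelow x z) z))
  have hs : E.IsSup D x := by
    intro t
    -- Taking suprema twice: expand `e(x, t)` over `z` in `⇓x`, then each `e(z, t)` over `⇓z`, and
    -- uncurry.
    rw [(hE x).2 t]
    simp only [LSub, D, iSup_himp_eq]
    rw [iInf_comm]
    refine iInf_congr fun z => ?_
    rw [show E.down t z = E.e z t from rfl, (hE z).2 t, LSub, himp_iInf_eq]
    exact iInf_congr fun y => by rw [himp_himp, inf_comm]
  refine (E.wayBelow_le hD hs y).trans (iSup_le fun d => ?_)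
  simp only [D, iSup_inf_eq]
  refine iSup_mono fun z => ?_
  calc E.wayBelow z d ⊓ E.wayBelow x z ⊓ E.e y d
      = E.e y d ⊓ E.wayBelow z d ⊓ E.wayBelow x z := by ac_rfl
    _ ≤ _ := inf_le_inf_right _ (E.e_inf_wayBelow_le _ _ _)

/-- By interpolation, `⇓s(y)` passes through some `z` way below `s`, and such a `z` lies below
members of `D`. -/
theorem IsContinuous.isScottOpen_wayAbove (y : P) : E.IsScottOpen fun x => E.wayBelow x y := by
  refine ⟨fun x x' => E.wayBelow_inf_e_le x x' y, fun D s hD hs => le_antisymm ?_ ?_⟩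
  · refine (hE.wayBelow_le_iSup s y).trans (iSup_le fun z => ?_)
    refine (inf_le_inf_left _ (E.wayBelow_le hD hs z)).trans ?_
    rw [lowerClosure, inf_iSup_eq]
    refine iSup_mono fun d => ?_
    rw [inf_comm (D d), ← inf_assoc]
    exact inf_le_inf_right _ (E.wayBelow_inf_e_le _ _ _)
  · exact iSup_le fun d => (inf_le_inf_left _ (hs.le d)).trans (E.wayBelow_inf_e_le _ _ _)

/-- The Scott open set of all elements that `y` is way below. -/
def IsContinuous.wayAbove (y : P) : E.scott.Open := ⟨_, hE.isScottOpen_wayAbove y⟩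

/-- The rounded ideal of `P` that corresponds to a point of the Scott `L`-topology. -/
def IsContinuous.ideal (p : E.scott.Pt) : P → L := fun y => p.1 (hE.wayAbove y)

/-- A point of the Scott `L`-topology is determined by its rounded ideal. -/
theorem IsContinuous.pt_apply (p : E.scott.Pt) (A : E.scott.Open) :
    p.1 A = ⨆ y, A.1 y ⊓ hE.ideal p y := by
  -- At `x` this is the Scott openness of `A` applied to `⇓x`; the weights `A(y)` enter as constant
  -- open sets.
  have hA : A = LTopology.Open.sup
      (Set.range fun y => (LTopology.Open.const E.scott (A.1 y)).inf (hE.wayAbove y)) := by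
    refine Subtype.ext (funext fun x => ?_)
    change A.1 x = (sSup (Subtype.val '' _) : P → L) x
    rw [sSup_image, iSup_range]
    simp only [iSup_apply]
    exact A.2.2 _ x (hE x).1 (hE x).2
  conv_lhs => rw [hA]
  rw [p.2.map_sup, iSup_range]
  exact iSup_congr fun y => by rw [p.2.map_inf, p.2.map_const]; rfl

theorem IsContinuous.ideal_eta (x : P) : hE.ideal (E.scott.eta x) = E.wayBelow x := rfl

theorem IsContinuous.ptOrder_e (p q : E.scott.Pt) :
    E.scott.ptOrder.e p q = LSub (hE.ideal p) (hE.ideal q) := by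
  refine le_antisymm (le_iInf fun y => iInf_le _ (hE.wayAbove y)) (le_LSub_iff.2 fun A => ?_)
  rw [hE.pt_apply p, hE.pt_apply q, inf_iSup_eq]
  refine iSup_mono fun y => ?_
  rw [inf_left_comm, inf_comm (LSub _ _)]
  exact inf_le_inf_left _ (LSub_inf_le _ _ y)

theorem IsContinuous.ideal_eq (p : E.scott.Pt) (y : P) :
    hE.ideal p y = ⨆ z, E.wayBelow z y ⊓ hE.ideal p z :=
  hE.pt_apply p (hE.wayAbove y)

theorem IsContinuous.isDirected_ideal (p : E.scott.Pt) : E.IsDirected (hE.ideal p) := by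
  refine ⟨?_, fun x y => ?_⟩
  · have h := hE.pt_apply p (LTopology.Open.const E.scott ⊤)
    rw [p.2.map_const] at h
    simpa [LTopology.Open.const] using h.symm
  · have h : hE.ideal p x ⊓ hE.ideal p y = _ := (p.2.map_inf _ _).symm.trans (hE.pt_apply p _)
    rw [h]
    refine iSup_mono fun z => ?_
    rw [inf_comm, inf_assoc]
    exact inf_le_inf_left _ (inf_le_inf (E.wayBelow_le_e _ _) (E.wayBelow_le_e _ _))

theorem IsContinuous.ideal_le (p : E.scott.Pt) (y : P) :
    hE.ideal p y ≤ E.scott.ptOrder.e (E.scott.eta y) p := by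
  rw [hE.ptOrder_e, hE.ideal_eta, le_LSub_iff]
  intro z
  rw [hE.ideal_eq p z, inf_comm]
  exact le_iSup (fun t => E.wayBelow t z ⊓ hE.ideal p t) y

end Continuous

/-! ### Directed suprema of points -/

/-- A point that is the pointwise join of an `L`-family of points is its supremum. -/
theorem isSup_pt_of_apply {T : LTopology L P} {X : Type w} {j : X → T.Pt} {D : X → L}
    {p : T.Pt} (h : ∀ A, p.1 A = ⨆ x, D x ⊓ (j x).1 A) : T.ptOrder.IsSup (LImage j D) p := by
  rw [isSup_LImage_iff]
  intro r
  change LSub p.1 r.1 = ⨅ x, D x ⇨ LSub (j x).1 r.1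
  simp only [LSub, h, iSup_himp_eq, himp_iInf_eq, himp_himp]
  rw [iInf_comm]

theorem LImage_id (D : P → L) : LImage id D = D := by
  funext y
  simp [LImage]

/-- The pointwise join of a directed `L`-subset of points is a point. -/
def directedJoin {T : LTopology L P} {D : T.Pt → L} (hD : T.ptOrder.IsDirected D) : T.Pt :=
  ⟨fun A => ⨆ q, D q ⊓ q.1 A,
    { map_inf := fun A B => by
        refine le_antisymm ?_ ?_
        · refine iSup_le fun q => ?_
          rw [q.2.map_inf]
          exact le_inf (le_iSup_of_le q (inf_le_inf_left _ inf_le_left))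
            (le_iSup_of_le q (inf_le_inf_left _ inf_le_right))
        · rw [iSup_inf_iSup]
          refine iSup_le fun ⟨q, q'⟩ => ?_
          calc D q ⊓ q.1 A ⊓ (D q' ⊓ q'.1 B) = q.1 A ⊓ q'.1 B ⊓ (D q ⊓ D q') := by ac_rfl
            _ ≤ _ := inf_le_inf_left _ (hD.2 q q')
            _ ≤ _ := by
              rw [inf_iSup_eq]
              refine iSup_mono fun r => ?_
              rw [r.2.map_inf]
              calc q.1 A ⊓ q'.1 B ⊓ (D r ⊓ LSub q.1 r.1 ⊓ LSub q'.1 r.1)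
                  = D r ⊓ ((q.1 A ⊓ LSub q.1 r.1) ⊓ (q'.1 B ⊓ LSub q'.1 r.1)) := by ac_rfl
                _ ≤ _ := inf_le_inf_left _ (inf_le_inf (LSub_inf_le _ _ A) (LSub_inf_le _ _ B))
      map_sup := fun S => by
        simp only [fun q : T.Pt => q.2.map_sup S, inf_iSup_eq]
        rw [iSup_comm]
        exact iSup_congr fun A => iSup_comm
      map_const := fun a => by
        simp only [fun q : T.Pt => q.2.map_const a]
        rw [← iSup_inf_eq, hD.1, top_inf_eq] }⟩

theorem isSup_directedJoin {T : LTopology L P} {D : T.Pt → L} (hD : T.ptOrder.IsDirected D) :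
    T.ptOrder.IsSup D (directedJoin hD) := by
  have h := isSup_pt_of_apply (j := id) (D := D) (p := directedJoin hD) fun _ => rfl
  rwa [LImage_id] at h

theorem isDcpo_ptOrder (T : LTopology L P) : T.ptOrder.IsDcpo :=
  fun _ hD => ⟨_, isSup_directedJoin hD⟩

theorem IsSup.pt_apply {T : LTopology L P} {D : T.Pt → L} {p : T.Pt}
    (hD : T.ptOrder.IsDirected D) (hp : T.ptOrder.IsSup D p) (A : T.Open) :
    p.1 A = ⨆ q, D q ⊓ q.1 A := by
  rw [hp.unique (isSup_directedJoin hD)]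
  rfl

theorem scottContinuous_eta (E : LOrder L P) : E.ScottContinuous E.scott.ptOrder E.scott.eta :=
  fun D s hD hs => isSup_pt_of_apply fun A =>
    (A.2.2 D s hD hs).trans (iSup_congr fun _ => inf_comm _ _)

/-! ### Continuity and the universal property -/

section Completion

variable {E : LOrder L P} (hE : E.IsContinuous)

include hE

theorem IsContinuous.isSup_LImage_eta_ideal (p : E.scott.Pt) :
    E.scott.ptOrder.IsSup (LImage E.scott.eta (hE.ideal p)) p :=
  isSup_pt_of_apply fun A => (hE.pt_apply p A).trans (iSup_congr fun _ => inf_comm _ _)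

theorem IsContinuous.isDirected_LImage_eta_ideal (p : E.scott.Pt) :
    E.scott.ptOrder.IsDirected (LImage E.scott.eta (hE.ideal p)) :=
  E.scottContinuous_eta.isDirected_image (hE.isDirected_ideal p)

/-- `≤` tests `⇓p` on the directed set `η^→(I_p)`. For `≥`, evaluation at `⇑y` preserves directed
suprema, so `I_p(y) ∧ e(p, ⊔D) ≤ ⋁_r D(r) ∧ I_r(y)`, and `I_r(y) ≤ e(η y, r)`. -/
theorem IsContinuous.wayBelow_pt (p : E.scott.Pt) :
    E.scott.ptOrder.wayBelow p =
      E.scott.ptOrder.lowerClosure (LImage E.scott.eta (hE.ideal p)) := by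
  funext q
  refine le_antisymm (wayBelow_le _ (hE.isDirected_LImage_eta_ideal p)
    (hE.isSup_LImage_eta_ideal p) q) (iSup_le fun r => ?_)
  simp only [LImage, iSup_inf_eq]
  refine iSup₂_le fun y hy => ?_
  subst hy
  refine le_wayBelow _ fun D s hD hs => ?_
  calc hE.ideal p y ⊓ E.scott.ptOrder.e q (E.scott.eta y) ⊓ E.scott.ptOrder.e p s
      = E.scott.ptOrder.e q (E.scott.eta y) ⊓ (hE.ideal p y ⊓ LSub p.1 s.1) := by
        rw [inf_right_comm, inf_comm]; rfl
    _ ≤ E.scott.ptOrder.e q (E.scott.eta y) ⊓ ⨆ r, D r ⊓ hE.ideal r y :=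
      inf_le_inf_left _ ((LSub_inf_le _ _ _).trans (hs.pt_apply hD _).le)
    _ ≤ _ := by
      rw [inf_iSup_eq]
      refine iSup_mono fun r => ?_
      rw [inf_left_comm]
      exact inf_le_inf_left _ ((inf_le_inf_left _ (hE.ideal_le r y)).trans (LOrder.trans _ _ _ _))

theorem IsContinuous.isContinuous_ptOrder : E.scott.ptOrder.IsContinuous := by
  intro p
  rw [hE.wayBelow_pt p]
  exact ⟨(hE.isDirected_LImage_eta_ideal p).lowerClosure,
    (hE.isSup_LImage_eta_ideal p).lowerClosure⟩

theorem IsContinuous.existsUnique_extension {G : LOrder L Q} (hG : G.IsDcpo) {f : P → Q}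
    (hf : E.ScottContinuous G f) :
    ∃! g : E.scott.Pt → Q, E.scott.ptOrder.ScottContinuous G g ∧ g ∘ E.scott.eta = f := by
  choose g hg using fun p : E.scott.Pt => hG _ (hf.isDirected_image (hE.isDirected_ideal p))
  refine ⟨g, ⟨fun D p hD hp => ?_, funext fun x => ?_⟩, fun g' hg' => funext fun p => ?_⟩
  · rw [isSup_LImage_iff]
    intro m
    simp only [fun p => isSup_LImage_iff.1 (hg p) m]
    -- Ideals of directed suprema are pointwise joins, so both sides become the same double infimum.
    have h (y : P) : hE.ideal p y = ⨆ q, D q ⊓ hE.ideal q y := hp.pt_apply hD _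
    simp only [h, iSup_himp_eq, himp_iInf_eq, himp_himp]
    rw [iInf_comm]
  · exact (hg (E.scott.eta x)).unique (hf _ _ (hE x).1 (hE x).2)
  · obtain ⟨hc, rfl⟩ := hg'
    -- `g'` preserves the supremum `p` of `η^→(I_p)`, so `g' p` is a supremum of `f^→(I_p)`, as is
    -- `g p`.
    refine IsSup.unique (isSup_LImage_iff.2 fun m => ?_) (hg p)
    rw [hc _ _ (hE.isDirected_LImage_eta_ideal p) (hE.isSup_LImage_eta_ideal p) m, LSub_LImage,
      LSub_LImage]
    rfl

theorem IsContinuous.isDirectedCompletion.{w'} :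
    IsDirectedCompletion.{w'} E E.scott.ptOrder E.scott.eta :=
  ⟨hE.isContinuous_ptOrder, isDcpo_ptOrder _, E.scottContinuous_eta,
    fun _ _ _ hG _ hf => hE.existsUnique_extension hG hf⟩

end Completion

end LOrder

/-! ### The reflection of categories -/

namespace LCPos

variable {L : Type u} [Order.Frame L]

/-- The directed completion of a continuous `L`-ordered set. -/
def completion (P : LCPos.{u, max u v} L) : LCDom.{u, max u v} L :=
  ⟨⟨P.order.scott.Pt, P.order.scott.ptOrder, P.continuous.isContinuous_ptOrder⟩,
    LOrder.isDcpo_ptOrder _⟩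

/-- The unit `η` of the directed completion. -/
def toCompletion (P : LCPos.{u, max u v} L) : P ⟶ P.completion.obj :=
  Hom.mk P.order.scott.eta P.order.scottContinuous_eta

theorem bijective_toCompletion_comp (P : LCPos.{u, max u v} L) (M : LCDom.{u, max u v} L) :
    Function.Bijective fun g : P.completion ⟶ M => P.toCompletion ≫ g.hom := by
  refine ⟨fun g g' h => ?_, fun f => ?_⟩
  · refine ObjectProperty.hom_ext _ (Hom.ext ?_)
    have hf := (P.toCompletion ≫ g.hom).scottContinuous
    exact (P.continuous.existsUnique_extension M.property hf).unique
      ⟨g.hom.scottContinuous, rfl⟩ ⟨g'.hom.scottContinuous, congrArg Hom.toFun h.symm⟩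
  · obtain ⟨g, ⟨hg, h⟩, -⟩ := P.continuous.existsUnique_extension M.property f.scottContinuous
    exact ⟨ObjectProperty.homMk (Hom.mk g hg), Hom.ext h⟩

/-- The universal property of the directed completion as a bijection of hom-sets. -/
noncomputable def completionHomEquiv (P : LCPos.{u, max u v} L) (M : LCDom.{u, max u v} L) :
    (P.completion ⟶ M) ≃ (P ⟶ (LCDom.inclusion.{u, max u v} L).obj M) :=
  Equiv.ofBijective _ (P.bijective_toCompletion_comp M)

/-- Precomposition with `η` is a bijection of hom-sets, natural in the target by associativity,
hence gives a left adjoint. Carriers live in `max u v` so that the set of points, made of `L`-valued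
maps on open sets, stays in the same universe. -/
theorem nonempty_reflective_inclusion :
    Nonempty (Reflective (LCDom.inclusion.{u, max u v} L)) :=
  ⟨{ L := _
     adj := Adjunction.adjunctionOfEquivLeft completionHomEquiv
       fun P _ _ h g => (Category.assoc P.toCompletion g.hom h.hom).symm }⟩

end LCPos

theorem mainTheorem3 (L : Type u) [Order.Frame L] :
    (∀ (P : Type v) (E : LOrder L P), E.IsContinuous →
      LOrder.IsDirectedCompletion.{w} E E.scott.ptOrder E.scott.eta) ∧
    Nonempty (Reflective (LCDom.inclusion.{u, max u v} L)) :=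
  ⟨fun _ _ hE => hE.isDirectedCompletion, LCPos.nonempty_reflective_inclusion⟩
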